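/- Conventions. For $n\in\mathbb N=\{1,2,\dots\}$ let $\mathbb F_n^+$ be the unital free semigroup on generators $g_1,\dots,g_n$, with word length $|\alpha|$, and let $F^2(H_n)$ be the full Fock space, with orthonormal basis $\{e_\alpha:\alpha\in\mathbb F_n^+\}$ and left creation operators $S_je_\alpha=e_{g_j\alpha}$, $1\le j\le n$. For $\mathbf n=(n_1,\dots,n_k)\in\mathbb N^k$ the universal model $\mathbf S^{(\mathbf n)}$ is the family of operators $\mathbf S_{i,j}=I\otimes\cdots\otimes I\otimes S_{j}\otimes I\otimes\cdots\otimes I$ ($S_j$ acting in the $i$-th factor, $1\le i\le k$, $1\le j\le n_i$) on $F^2(H_{n_1})\otimes\cdots\otimes F^2(H_{n_k})$. For $q=(q_1,\dots,q_k)\in\mathbb Z_+^k$ let $P_{\le q}$ be the orthogonal projection of $F^2(H_{n_1})\otimes\cdots\otimes F^2(H_{n_k})$ onto the span of all $e_{\alpha_1}\otimes\cdots\otimes e_{\alpha_k}$ with $|\alpha_i|\le q_i$ for all $i$. Let $\mathcal E$ be a finite dimensional complex Hilbert space. A subspace of $F^2(H_{n_1})\otimes\cdots\otimes F^2(H_{n_k})\otimes\mathcal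 E$ is invariant (respectively coinvariant) under $\mathbf S^{(\mathbf n)}\otimes I_{\mathcal E}$ if it is invariant under every $\mathbf S_{i,j}\otimes I_{\mathcal E}$ (respectively under every $(\mathbf S_{i,j}\otimes I_{\mathcal E})^*$). For a closed coinvariant subspace $\mathcal N$ (that is, $\mathcal N=\mathcal M^\perp$ with $\mathcal M$ invariant), with orthogonal projection $P_{\mathcal N}$, the Euler characteristic is the iterated limit $$\chi(\mathcal N):=\lim_{q_1\to\infty}\cdots\lim_{q_k\to\infty}\frac{\operatorname{rank}\left[P_{\mathcal N}\left(P_{\le (q_1,\dots,q_k)}\otimes I_{\mathcal E}\right)\right]}{\operatorname{rank}\left[P_{\le (q_1,\dots,q_k)}\right]}.$$ Theorem. Let $\kappa(1),\dots,\kappa(p)\in\mathbb N$ and $\mathbf n^{(i)}=(n^{(i)}_1,\dots,n^{(i)}_{\kappa(i)})\in\mathbb N^{\kappa(i)}$ for $i=1,\dots,p$. For each $i$ let $\mathcal E_i$ be a finite dimensional complex Hilbert space and let $\mathcal M_i\subseteq F^2(H_{n^{(i)}_1})\otimes\cdots\otimes F^2(H_{n^{(i)}_{\kappa(i)}})\otimes\mathcal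 E_i$ be an invariant subspace under $\mathbf S^{(\mathbf n^{(i)})}\otimes I_{\mathcal E_i}$. Let $\mathcal M_1^\perp\otimes\cdots\otimes\mathcal M_p^\perp$ be the Hilbert space tensor product (the closed linear span of the elementary tensors), regarded, by reordering the tensor factors, as a subspace of $$\Big(\bigotimes_{i=1}^p\bigotimes_{r=1}^{\kappa(i)}F^2(H_{n^{(i)}_r})\Big)\otimes(\mathcal E_1\otimes\cdots\otimes\mathcal E_p).$$ Then this subspace is coinvariant under $\mathbf S^{(\mathbf n^{(1)},\dots,\mathbf n^{(p)})}\otimes I_{\mathcal E_1\otimes\cdots\otimes\mathcal E_p}$, where $(\mathbf n^{(1)},\dots,\mathbf n^{(p)})$ is the concatenated tuple in $\mathbb N^{\kappa(1)+\cdots+\kappa(p)}$; the Euler characteristics of all $\mathcal M_i^\perp$ and of $\mathcal M_1^\perp\otimes\cdots\otimes\mathcal M_p^\perp$ exist; and $$\chi(\mathcal M_1^\perp\otimes\cdots\otimes\mathcal M_p^\perp)=\prod_{i=1}^p\chi(\mathcal M_i^\perp).$$ -/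

import Mathlib

open Filter Topology
open scoped TensorProduct

noncomputable section

namespace Polyball

/-! ### Fock spaces -/

/-- Tuples of words `(α_i)_{i ∈ ι}`, where `α_i` lies in the unital free semigroup on `n i`
generators. They index the orthonormal basis `⊗_i e_{α_i}` of `⊗_i F²(H_{n i})`. -/
abbrev Words {ι : Type*} (n : ι → ℕ) : Type _ := ∀ i, FreeMonoid (Fin (n i))

/-- The Hilbert space `(⊗_{i ∈ ι} F²(H_{n i})) ⊗ E`, written in the orthonormal basis
`⊗_i e_{α_i}` as the space of square summable `E`-valued functions on tuples of words:
`lp.single 2 w x` is the vector `(⊗_i e_{w i}) ⊗ x`. -/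
abbrev Fock {ι : Type*} (n : ι → ℕ) (E : Type*) [NormedAddCommGroup E] : Type _ :=
  lp (fun _ : Words n => E) 2

instance Fock.completeSpace {ι : Type*} (n : ι → ℕ) (E : Type*) [NormedAddCommGroup E]
    [InnerProductSpace ℂ E] [FiniteDimensional ℂ E] : CompleteSpace (Fock n E) :=
  haveI : CompleteSpace E := FiniteDimensional.complete ℂ E
  inferInstance

theorem norm_sq_extend {W E : Type*} [NormedAddCommGroup E] {φ : W → W}
    (hφ : Function.Injective φ) (f : W → E) :
    (fun w => ‖Function.extend φ f 0 w‖ ^ (2 : ENNReal).toReal) =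
      Function.extend φ (fun w => ‖f w‖ ^ (2 : ENNReal).toReal) 0 := by
  funext w
  by_cases h : ∃ v, φ v = w
  · obtain ⟨v, rfl⟩ := h
    simp [hφ.extend_apply]
  · simp [Function.extend_apply' _ _ _ h]

/-- For an injective map `φ` of the index set, the isometry of `ℓ²(W; E)` which sends
`lp.single 2 w x` to `lp.single 2 (φ w) x`. -/
def pushIsometry {W : Type*} (E : Type*) [NormedAddCommGroup E] [InnerProductSpace ℂ E]
    (φ : W → W) (hφ : Function.Injective φ) :
    lp (fun _ : W => E) 2 →ₗᵢ[ℂ] lp (fun _ : W => E) 2 where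
  toFun f := ⟨Function.extend φ f 0, by
    apply memℓp_gen
    rw [norm_sq_extend hφ, summable_extend_zero hφ]
    exact (memℓp_gen_iff (by norm_num)).1 (lp.memℓp f)⟩
  map_add' f g := by
    apply lp.ext
    funext w
    change Function.extend φ (f + g : W → E) 0 w =
      Function.extend φ f 0 w + Function.extend φ g 0 w
    by_cases h : ∃ v, φ v = w
    · obtain ⟨v, rfl⟩ := h
      simp [hφ.extend_apply]
    · simp [Function.extend_apply' _ _ _ h]
  map_smul' c f := by
    apply lp.ext
    funext w
    change Function.extend φ (c • f : W → E) 0 w = c • Function.extend φ f 0 w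
    by_cases h : ∃ v, φ v = w
    · obtain ⟨v, rfl⟩ := h
      simp [hφ.extend_apply]
    · simp [Function.extend_apply' _ _ _ h]
  norm_map' f := by
    rw [lp.norm_eq_tsum_rpow (by norm_num), lp.norm_eq_tsum_rpow (by norm_num)]
    congr 1
    exact (congrArg tsum (norm_sq_extend hφ f)).trans (tsum_extend_zero hφ _)

/-- Replace the `i`-th word `α_i` by `g_j α_i`. -/
def prepend {ι : Type*} [DecidableEq ι] {n : ι → ℕ} (i : ι) (j : Fin (n i)) (w : Words n) :
    Words n :=
  Function.update w i (FreeMonoid.of j * w i)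

theorem prepend_injective {ι : Type*} [DecidableEq ι] {n : ι → ℕ} (i : ι) (j : Fin (n i)) :
    Function.Injective (prepend (n := n) i j) := by
  intro v w h
  funext r
  have hr := congrFun h r
  by_cases hri : r = i
  · subst hri
    simpa [prepend] using hr
  · simpa [prepend, hri] using hr

/-- The operator `𝐒_{i,j} ⊗ I_E`, where `𝐒_{i,j}` is the left creation operator `S_{i,j}` acting
in the `i`-th tensor factor. The operators `𝐒_{i,j}` form the universal model of the polyball. -/
def creation {ι : Type*} [DecidableEq ι] (n : ι → ℕ) (E : Type*) [NormedAddCommGroup E]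
    [InnerProductSpace ℂ E] (i : ι) (j : Fin (n i)) : Fock n E →L[ℂ] Fock n E :=
  (pushIsometry E (prepend i j) (prepend_injective i j)).toContinuousLinearMap

open Classical in
theorem creation_single {ι : Type*} [DecidableEq ι] {n : ι → ℕ} (E : Type*)
    [NormedAddCommGroup E] [InnerProductSpace ℂ E] (i : ι) (j : Fin (n i))
    (w : Words n) (x : E) :
    creation n E i j (lp.single 2 w x) = lp.single 2 (prepend i j w) x := by
  apply lp.ext
  funext v
  change Function.extend (prepend i j) (lp.single 2 w x) 0 v = _
  by_cases h : ∃ u, prepend i j u = v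
  · obtain ⟨u, rfl⟩ := h
    rw [(prepend_injective i j).extend_apply]
    by_cases huw : u = w
    · subst huw
      simp
    · rw [lp.single_apply_ne _ _ _ huw,
        lp.single_apply_ne _ _ _ (fun h => huw (prepend_injective i j h))]
  · rw [Function.extend_apply' _ _ _ h, lp.single_apply_ne _ _ _ (fun hv => h ⟨w, hv.symm⟩)]
    rfl

/-- `M` is invariant under all the operators `𝐒_{i,j} ⊗ I_E`. -/
def IsInvariant {ι : Type*} [DecidableEq ι] {n : ι → ℕ} {E : Type*} [NormedAddCommGroup E]
    [InnerProductSpace ℂ E] (M : Submodule ℂ (Fock n E)) : Prop :=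
  ∀ (i : ι) (j : Fin (n i)), ∀ f ∈ M, creation n E i j f ∈ M

/-- `N` is invariant under all the adjoints `(𝐒_{i,j} ⊗ I_E)*`. -/
def IsCoinvariant {ι : Type*} [DecidableEq ι] {n : ι → ℕ} {E : Type*} [NormedAddCommGroup E]
    [InnerProductSpace ℂ E] [FiniteDimensional ℂ E] (N : Submodule ℂ (Fock n E)) : Prop :=
  ∀ (i : ι) (j : Fin (n i)), ∀ f ∈ N,
    ContinuousLinearMap.adjoint (creation n E i j) f ∈ N

/-! ### The Euler characteristic of a coinvariant subspace -/

/-- The closed span of the vectors `(⊗_i e_{α_i}) ⊗ x` with `|α_i| ≤ q i` for all `i`. -/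
def truncSpace {ι : Type*} (n : ι → ℕ) (E : Type*) [NormedAddCommGroup E]
    [InnerProductSpace ℂ E] (q : ι → ℕ) : Submodule ℂ (Fock n E) :=
  open Classical in
  (Submodule.span ℂ {f : Fock n E | ∃ (w : Words n) (x : E),
    (∀ i, (w i).length ≤ q i) ∧ f = lp.single 2 w x}).topologicalClosure

instance truncSpace.completeSpace {ι : Type*} (n : ι → ℕ) (E : Type*) [NormedAddCommGroup E]
    [InnerProductSpace ℂ E] [FiniteDimensional ℂ E] (q : ι → ℕ) :
    CompleteSpace (truncSpace n E q) :=
  Submodule.topologicalClosure.completeSpace _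

/-- The orthogonal projection `P_{≤ q} ⊗ I_E`. For `E = ℂ` this is `P_{≤ q}` itself. -/
def truncProj {ι : Type*} (n : ι → ℕ) (E : Type*) [NormedAddCommGroup E]
    [InnerProductSpace ℂ E] [FiniteDimensional ℂ E] (q : ι → ℕ) : Fock n E →L[ℂ] Fock n E :=
  (truncSpace n E q).starProjection

/-- The rank of a (finite rank) operator. -/
def opRank {H : Type*} [NormedAddCommGroup H] [InnerProductSpace ℂ H] (T : H →L[ℂ] H) : ℕ :=
  Module.finrank ℂ (LinearMap.range (T : H →ₗ[ℂ] H))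

/-- The quotient `rank [P_N (P_{≤ q} ⊗ I_E)] / rank [P_{≤ q}]`, with `P_N` the orthogonal
projection onto `N`. -/
def rankRatio {ι : Type*} {n : ι → ℕ} {E : Type*} [NormedAddCommGroup E]
    [InnerProductSpace ℂ E] [FiniteDimensional ℂ E] (N : Submodule ℂ (Fock n E))
    [N.HasOrthogonalProjection] (q : ι → ℕ) : ℝ :=
  (opRank (N.starProjection ∘L truncProj n E q) : ℝ) / (opRank (truncProj n ℂ q) : ℝ)

/-- `HasIteratedLim k a L` says that the iterated limit
`lim_{q_1 → ∞} lim_{q_2 → ∞} ⋯ lim_{q_k → ∞} a (q_1, …, q_k)` exists and equals `L`. -/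
def HasIteratedLim : (k : ℕ) → ((Fin k → ℕ) → ℝ) → ℝ → Prop
  | 0, a, L => a Fin.elim0 = L
  | k + 1, a, L => ∃ b : ℕ → ℝ,
      (∀ q₁ : ℕ, HasIteratedLim k (fun q => a (Fin.cons q₁ q)) (b q₁)) ∧ Tendsto b atTop (𝓝 L)

theorem HasIteratedLim.unique : ∀ {k : ℕ} {a : (Fin k → ℕ) → ℝ} {L L' : ℝ},
    HasIteratedLim k a L → HasIteratedLim k a L' → L = L'
  | 0, _, _, _, h, h' => h.symm.trans h'
  | _ + 1, _, _, _, ⟨b, hb, hL⟩, ⟨b', hb', hL'⟩ => by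
      obtain rfl : b = b' := funext fun q₁ => (hb q₁).unique (hb' q₁)
      exact tendsto_nhds_unique hL hL'

/-- The Euler characteristic of `N` exists and equals `c`. Here `e` lists the tensor factors as
the first, second, …, `k`-th one. -/
def HasEulerChar {ι : Type*} {k : ℕ} (e : ι ≃ Fin k) {n : ι → ℕ} {E : Type*}
    [NormedAddCommGroup E] [InnerProductSpace ℂ E] [FiniteDimensional ℂ E]
    (N : Submodule ℂ (Fock n E)) [N.HasOrthogonalProjection] (c : ℝ) : Prop :=
  HasIteratedLim k (fun q => rankRatio N (fun i => q (e i))) c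

/-- The Euler characteristic `χ(N)`, with the default value `0` if the limit does not exist. -/
def eulerChar {ι : Type*} {k : ℕ} (e : ι ≃ Fin k) {n : ι → ℕ} {E : Type*}
    [NormedAddCommGroup E] [InnerProductSpace ℂ E] [FiniteDimensional ℂ E]
    (N : Submodule ℂ (Fock n E)) [N.HasOrthogonalProjection] : ℝ :=
  open Classical in if h : ∃ c, HasEulerChar e N c then h.choose else 0

theorem HasEulerChar.eulerChar_eq {ι : Type*} {k : ℕ} {e : ι ≃ Fin k} {n : ι → ℕ} {E : Type*}
    [NormedAddCommGroup E] [InnerProductSpace ℂ E] [FiniteDimensional ℂ E]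
    {N : Submodule ℂ (Fock n E)} [N.HasOrthogonalProjection] {c : ℝ}
    (h : HasEulerChar e N c) : eulerChar e N = c := by
  have h' : ∃ c, HasEulerChar e N c := ⟨c, h⟩
  rw [eulerChar, dif_pos h']
  exact HasIteratedLim.unique h'.choose_spec h

/-! ### Tensor products -/

/-- The Hilbert space tensor product `E_1 ⊗ ⋯ ⊗ E_p` of finite dimensional Hilbert spaces: the
algebraic tensor product with the inner product determined by
`⟪x_1 ⊗ ⋯ ⊗ x_p, y_1 ⊗ ⋯ ⊗ y_p⟫ = ∏_i ⟪x_i, y_i⟫` (see `FinTensor.inner_tprod`). -/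
def FinTensor {p : ℕ} (E : Fin p → Type*) [∀ i, NormedAddCommGroup (E i)]
    [∀ i, InnerProductSpace ℂ (E i)] : Type _ :=
  ⨂[ℂ] i, E i

section FinTensor

variable {p : ℕ} (E : Fin p → Type*) [∀ i, NormedAddCommGroup (E i)]
  [∀ i, InnerProductSpace ℂ (E i)]

instance FinTensor.instAddCommGroup : AddCommGroup (FinTensor E) :=
  inferInstanceAs (AddCommGroup (⨂[ℂ] i, E i))

instance FinTensor.instModule : Module ℂ (FinTensor E) :=
  inferInstanceAs (Module ℂ (⨂[ℂ] i, E i))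

/-- The elementary tensor `x_1 ⊗ ⋯ ⊗ x_p`, as a multilinear map. -/
def FinTensor.tprod : MultilinearMap ℂ E (FinTensor E) :=
  PiTensorProduct.tprod ℂ

variable [∀ i, FiniteDimensional ℂ (E i)]

instance FinTensor.finiteDimensional : FiniteDimensional ℂ (FinTensor E) :=
  inferInstanceAs (FiniteDimensional ℂ (⨂[ℂ] i, E i))

/-- Coordinates with respect to the tensor products of orthonormal basis vectors. -/
def FinTensor.coord :
    FinTensor E ≃ₗ[ℂ] EuclideanSpace ℂ (∀ i, Fin (Module.finrank ℂ (E i))) :=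
  (Basis.piTensorProduct (fun i => (stdOrthonormalBasis ℂ (E i)).toBasis)).equivFun ≪≫ₗ
    (WithLp.linearEquiv 2 ℂ _).symm

instance FinTensor.instNormedAddCommGroup : NormedAddCommGroup (FinTensor E) :=
  NormedAddCommGroup.induced (FinTensor E) _ (FinTensor.coord E) (FinTensor.coord E).injective

instance FinTensor.instInnerProductSpace : InnerProductSpace ℂ (FinTensor E) :=
  InnerProductSpace.induced (FinTensor.coord E)

theorem FinTensor.inner_tprod (x y : ∀ i, E i) :
    inner ℂ (FinTensor.tprod E x) (FinTensor.tprod E y) = ∏ i, inner ℂ (x i) (y i) := by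
  have hc : ∀ (z : ∀ i, E i) (j : ∀ i, Fin (Module.finrank ℂ (E i))),
      FinTensor.coord E (FinTensor.tprod E z) j =
        ∏ i, (stdOrthonormalBasis ℂ (E i)).repr (z i) (j i) := by
    intro z j
    exact Basis.piTensorProduct_repr_tprod_apply _ _ _
  have h1 : inner ℂ (FinTensor.tprod E x) (FinTensor.tprod E y) =
      inner ℂ (FinTensor.coord E (FinTensor.tprod E x)) (FinTensor.coord E (FinTensor.tprod E y)) :=
    rfl
  rw [h1, PiLp.inner_apply]
  simp_rw [hc]
  have h2 : ∀ i, inner ℂ (x i) (y i) = ∑ j, inner ℂ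
      ((stdOrthonormalBasis ℂ (E i)).repr (x i) j) ((stdOrthonormalBasis ℂ (E i)).repr (y i) j) := by
    intro i
    rw [← PiLp.inner_apply, LinearIsometryEquiv.inner_map_map]
  simp_rw [h2]
  rw [Finset.prod_univ_sum, Fintype.piFinset_univ]
  refine Finset.sum_congr rfl fun j _ => ?_
  simp [Finset.prod_mul_distrib]

theorem FinTensor.norm_tprod (x : ∀ i, E i) : ‖FinTensor.tprod E x‖ = ∏ i, ‖x i‖ := by
  have h : ((‖FinTensor.tprod E x‖ ^ 2 : ℝ) : ℂ) = (((∏ i, ‖x i‖) ^ 2 : ℝ) : ℂ) := by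
    have h1 := FinTensor.inner_tprod E x x
    simp only [inner_self_eq_norm_sq_to_K] at h1
    rw [← Finset.prod_pow]
    push_cast
    exact h1
  have h' : ‖FinTensor.tprod E x‖ ^ 2 = (∏ i, ‖x i‖) ^ 2 := by exact_mod_cast h
  exact (pow_left_inj₀ (norm_nonneg _) (Finset.prod_nonneg fun i _ => norm_nonneg _)
    two_ne_zero).1 h'

end FinTensor

theorem summable_prod_pi {p : ℕ} {W : Fin p → Type*} (g : ∀ i, W i → ℝ)
    (hg : ∀ i v, 0 ≤ g i v) (hs : ∀ i, Summable (g i)) :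
    Summable fun v : (∀ i, W i) => ∏ i, g i (v i) := by
  classical
  refine summable_of_sum_le (c := ∏ i, ∑' v, g i v)
    (fun v => Finset.prod_nonneg fun i _ => hg i _) fun u => ?_
  calc ∑ v ∈ u, ∏ i, g i (v i)
      ≤ ∑ v ∈ Fintype.piFinset (fun i => u.image fun v => v i), ∏ i, g i (v i) :=
        Finset.sum_le_sum_of_subset_of_nonneg
          (fun v hv => Fintype.mem_piFinset.2 fun i => Finset.mem_image_of_mem _ hv)
          (fun v _ _ => Finset.prod_nonneg fun i _ => hg i _)
    _ = ∏ i, ∑ v ∈ u.image (fun v => v i), g i v := (Finset.prod_univ_sum _ _).symm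
    _ ≤ ∏ i, ∑' v, g i v :=
        Finset.prod_le_prod (fun i _ => Finset.sum_nonneg fun v _ => hg i v)
          (fun i _ => (hs i).sum_le_tsum _ fun v _ => hg i v)

/-- The concatenation `(n^{(1)}, …, n^{(p)})` of `n^{(i)} = (n^{(i)}_1, …, n^{(i)}_{κ i})`, as a
function on the pairs `(i, r)` with `r ≤ κ i`. -/
def concat {p : ℕ} {κ : Fin p → ℕ} (n : ∀ i, Fin (κ i) → ℕ) (s : Σ i, Fin (κ i)) : ℕ :=
  n s.1 s.2

/-- The elementary tensor `f_1 ⊗ ⋯ ⊗ f_p` of `f_i ∈ (⊗_r F²(H_{n^{(i)}_r})) ⊗ E_i`, where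
`⊗_i [(⊗_r F²(H_{n^{(i)}_r})) ⊗ E_i]` is identified with
`(⊗_{i,r} F²(H_{n^{(i)}_r})) ⊗ (E_1 ⊗ ⋯ ⊗ E_p)` by reordering the factors. -/
def fockTensor {p : ℕ} {κ : Fin p → ℕ} {n : ∀ i, Fin (κ i) → ℕ} {E : Fin p → Type*}
    [∀ i, NormedAddCommGroup (E i)] [∀ i, InnerProductSpace ℂ (E i)]
    [∀ i, FiniteDimensional ℂ (E i)] (f : ∀ i, Fock (n i) (E i)) :
    Fock (concat n) (FinTensor E) :=
  ⟨fun w => FinTensor.tprod E fun i => f i fun r => w ⟨i, r⟩, by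
    apply memℓp_gen
    have hs := summable_prod_pi (fun i (v : Words (n i)) => ‖f i v‖ ^ (2 : ENNReal).toReal)
      (fun i v => by positivity)
      (fun i => (memℓp_gen_iff (by norm_num)).1 (lp.memℓp (f i)))
    have hinj : Function.Injective
        (fun (w : Words (concat n)) (i : Fin p) (r : Fin (κ i)) => w ⟨i, r⟩) := by
      intro w w' h
      funext s
      exact congrFun (congrFun h s.1) s.2
    refine (hs.comp_injective hinj).congr fun w => ?_
    simp only [FinTensor.norm_tprod]
    exact (Real.finsetProd_rpow _ _ (fun i _ => norm_nonneg _) _)⟩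

/-- The Hilbert space tensor product `N_1 ⊗ ⋯ ⊗ N_p` of subspaces: the closed linear span of the
elementary tensors `f_1 ⊗ ⋯ ⊗ f_p` with `f_i ∈ N_i`. -/
def tensorSubspace {p : ℕ} {κ : Fin p → ℕ} {n : ∀ i, Fin (κ i) → ℕ} {E : Fin p → Type*}
    [∀ i, NormedAddCommGroup (E i)] [∀ i, InnerProductSpace ℂ (E i)]
    [∀ i, FiniteDimensional ℂ (E i)] (N : ∀ i, Submodule ℂ (Fock (n i) (E i))) :
    Submodule ℂ (Fock (concat n) (FinTensor E)) :=
  (Submodule.span ℂ {g | ∃ f : ∀ i, Fock (n i) (E i),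
    (∀ i, f i ∈ N i) ∧ g = fockTensor f}).topologicalClosure

instance tensorSubspace.completeSpace {p : ℕ} {κ : Fin p → ℕ} {n : ∀ i, Fin (κ i) → ℕ}
    {E : Fin p → Type*} [∀ i, NormedAddCommGroup (E i)] [∀ i, InnerProductSpace ℂ (E i)]
    [∀ i, FiniteDimensional ℂ (E i)] (N : ∀ i, Submodule ℂ (Fock (n i) (E i))) :
    CompleteSpace (tensorSubspace N) :=
  Submodule.topologicalClosure.completeSpace _

end Polyball

end

open Polyball

/-! For coinvariant `N`, the rank ratio decreases in each `q i` separately (`rankRatio_antitone`).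
Indeed `P_N S = P_N S P_N`, so the compressed operators `P_N S_{i,j}` generate each compressed
truncation from the preceding one. A complement of one stage in the next has at most `n i` images,
so the increments of the dimension grow at most by the factor `n i` (`finrank_le_of_le_sup_map`).
The geometric sums in the denominator satisfy the same recursion with equality, and the quotient
decreases (`div_geom_sum_succ_le`).

A nonnegative antitone function on tuples has an iterated limit equal to its infimum, which is also
its joint limit as all coordinates grow (`exists_hasIteratedLim_of_antitone`). This gives existence
and replaces iterated limits by joint ones, which do not depend on the order of the factors.

Truncations and orthogonal projections are compatible with tensor products, so the rank ratio of the
tensor product is exactly the product of the rank ratios (`rankRatio_tensorSubspace`). The joint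
limit of a product over disjoint blocks of variables is the product of the limits. -/

noncomputable section

namespace Polyball

/-! ### Words of bounded length -/

/-- The words of length at most `q` on `m` generators. -/
def wordsLE (m q : ℕ) : Finset (FreeMonoid (Fin m)) :=
  (List.finite_length_le (Fin m) q).toFinset

theorem mem_wordsLE {m q : ℕ} {w : FreeMonoid (Fin m)} : w ∈ wordsLE m q ↔ w.length ≤ q :=
  (Set.Finite.mem_toFinset _).trans Iff.rfl

/-- Words are counted by length: those of length `l` are the vectors of `l` letters. -/
theorem card_wordsLE (m q : ℕ) : (wordsLE m q).card = ∑ l ∈ Finset.range (q + 1), m ^ l := by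
  classical
  rw [Finset.card_eq_sum_card_fiberwise (f := FreeMonoid.length) (t := Finset.range (q + 1))
    fun w hw => by
      simpa [Nat.lt_succ_iff] using mem_wordsLE.1 hw]
  refine Finset.sum_congr rfl fun l hl => ?_
  have hl' : l ≤ q := Nat.lt_succ_iff.1 (Finset.mem_range.1 hl)
  have h := card_vector (α := Fin m) l
  rw [Fintype.card_fin] at h
  rw [← h]
  have : Fintype {w : FreeMonoid (Fin m) // w.length = l} :=
    inferInstanceAs (Fintype (List.Vector (Fin m) l))
  refine .trans (Fintype.card_of_subtype (p := fun w : FreeMonoid (Fin m) => w.length = l) _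
    fun w => ?_).symm (Fintype.card_congr (Equiv.refl _))
  rw [Finset.mem_filter, mem_wordsLE]
  exact ⟨fun h => h.2, fun h => ⟨h.le.trans hl', h⟩⟩

/-- The tuples of words `w` with `|w i| ≤ q i` for all `i`. -/
def box {ι : Type*} [Fintype ι] [DecidableEq ι] (n : ι → ℕ) (q : ι → ℕ) : Finset (Words n) :=
  Fintype.piFinset fun i => wordsLE (n i) (q i)

theorem mem_box {ι : Type*} [Fintype ι] [DecidableEq ι] {n : ι → ℕ} {q : ι → ℕ} {w : Words n} :
    w ∈ box n q ↔ ∀ i, (w i).length ≤ q i := by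
  simp [box, mem_wordsLE]

theorem card_box {ι : Type*} [Fintype ι] [DecidableEq ι] (n : ι → ℕ) (q : ι → ℕ) :
    (box n q).card = ∏ i, ∑ l ∈ Finset.range (q i + 1), n i ^ l := by
  simp [box, card_wordsLE]

/-! ### The truncated spaces -/

open Classical in
/-- The vector `(⊗_i e_{w i}) ⊗ x`. -/
def tensorVec {ι : Type*} {n : ι → ℕ} {E : Type*} [NormedAddCommGroup E] (w : Words n) (x : E) :
    Fock n E :=
  lp.single 2 w x

open Classical in
theorem tensorVec_apply_self {ι : Type*} {n : ι → ℕ} {E : Type*} [NormedAddCommGroup E]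
    (w : Words n) (x : E) : tensorVec w x w = x :=
  lp.single_apply_self _ _ _

open Classical in
theorem tensorVec_apply_ne {ι : Type*} {n : ι → ℕ} {E : Type*} [NormedAddCommGroup E]
    {v w : Words n} (h : v ≠ w) (x : E) : tensorVec w x v = 0 :=
  lp.single_apply_ne _ _ _ h

theorem creation_tensorVec {ι : Type*} [DecidableEq ι] {n : ι → ℕ} {E : Type*}
    [NormedAddCommGroup E] [InnerProductSpace ℂ E] (i : ι) (j : Fin (n i)) (w : Words n) (x : E) :
    creation n E i j (tensorVec w x) = tensorVec (prepend i j w) x :=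
  creation_single E i j w x

open Classical in
theorem inner_tensorVec_left {ι : Type*} {n : ι → ℕ} {E : Type*} [NormedAddCommGroup E]
    [InnerProductSpace ℂ E] (w : Words n) (x : E) (f : Fock n E) :
    inner ℂ (tensorVec w x) f = inner ℂ x (f w) :=
  lp.inner_single_left (G := fun _ : Words n => E) (𝕜 := ℂ) w x f

theorem tensorVec_mem_truncSpace {ι : Type*} {n : ι → ℕ} {E : Type*} [NormedAddCommGroup E]
    [InnerProductSpace ℂ E] {q : ι → ℕ} {w : Words n} (hw : ∀ i, (w i).length ≤ q i) (x : E) :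
    tensorVec w x ∈ truncSpace n E q :=
  Submodule.le_topologicalClosure _ (Submodule.subset_span ⟨w, x, hw, rfl⟩)

theorem opRank_starProjection_comp_truncProj {ι : Type*} {n : ι → ℕ} {E : Type*}
    [NormedAddCommGroup E] [InnerProductSpace ℂ E] [FiniteDimensional ℂ E] (N : Submodule ℂ (Fock n E))
    [N.HasOrthogonalProjection] (q : ι → ℕ) :
    opRank (N.starProjection ∘L truncProj n E q) =
      Module.finrank ℂ ((truncSpace n E q).map
        (N.starProjection : Fock n E →ₗ[ℂ] Fock n E)) := by
  rw [opRank, ContinuousLinearMap.toLinearMap_comp, LinearMap.range_comp, truncProj,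
    Submodule.range_starProjection]

section Trunc

variable {ι : Type*} [Fintype ι] [DecidableEq ι] {n : ι → ℕ} {E : Type*} [NormedAddCommGroup E]

theorem eq_sum_tensorVec {q : ι → ℕ} {f : Fock n E} (hf : ∀ w ∉ box n q, f w = 0) :
    f = ∑ w ∈ box n q, tensorVec w (f w) := by
  apply lp.ext
  funext v
  rw [lp.coeFn_sum, Finset.sum_apply]
  by_cases hv : v ∈ box n q
  · rw [Finset.sum_eq_single_of_mem v hv fun w _ hw => tensorVec_apply_ne hw.symm _,
      tensorVec_apply_self]
  · rw [hf v hv, Finset.sum_eq_zero]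
    intro w hw
    refine tensorVec_apply_ne ?_ _
    rintro rfl
    exact hv hw

variable [InnerProductSpace ℂ E]

/-- The functions supported on the box given by `q`. -/
def supportedOn (n : ι → ℕ) (E : Type*) [NormedAddCommGroup E] [InnerProductSpace ℂ E]
    (q : ι → ℕ) : Submodule ℂ (Fock n E) where
  carrier := {f | ∀ w ∉ box n q, f w = 0}
  add_mem' {f g} hf hg w hw := by
    rw [lp.coeFn_add, Pi.add_apply, hf w hw, hg w hw, add_zero]
  zero_mem' _ _ := rfl
  smul_mem' c f hf w hw := by
    rw [lp.coeFn_smul, Pi.smul_apply, hf w hw, smul_zero]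

/-- A function supported on a box is given by its values there. -/
def supportedOnEquiv (n : ι → ℕ) (E : Type*) [NormedAddCommGroup E] [InnerProductSpace ℂ E]
    (q : ι → ℕ) : supportedOn n E q ≃ₗ[ℂ] (box n q → E) where
  toFun f w := (f : Fock n E) w
  map_add' _ _ := rfl
  map_smul' _ _ := rfl
  invFun g := ⟨∑ w : box n q, tensorVec (w : Words n) (g w), fun v hv => by
    rw [lp.coeFn_sum, Finset.sum_apply]
    refine Finset.sum_eq_zero fun w _ => tensorVec_apply_ne ?_ _
    rintro rfl
    exact hv w.2⟩
  left_inv f := by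
    apply Subtype.ext
    conv_rhs => rw [eq_sum_tensorVec f.2]
    exact Finset.sum_coe_sort (box n q) fun w => tensorVec w ((f : Fock n E) w)
  right_inv g := by
    funext v
    change (∑ w : box n q, tensorVec (w : Words n) (g w) : Fock n E) v = g v
    rw [lp.coeFn_sum, Finset.sum_apply, Finset.sum_eq_single v]
    · exact tensorVec_apply_self _ _
    · intro w _ hw
      exact tensorVec_apply_ne (fun h => hw (Subtype.ext h.symm)) _
    · simp

variable [FiniteDimensional ℂ E]

instance supportedOn.finiteDimensional (q : ι → ℕ) :
    FiniteDimensional ℂ (supportedOn n E q) :=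
  (supportedOnEquiv n E q).symm.finiteDimensional

/-- The closure adds nothing: boxes are finite, so the functions supported on one form a finite
dimensional, hence closed, space. -/
theorem truncSpace_eq (q : ι → ℕ) : truncSpace n E q = supportedOn n E q := by
  classical
  apply le_antisymm
  · refine Submodule.topologicalClosure_minimal _ (Submodule.span_le.2 ?_)
      (Submodule.closed_of_finiteDimensional _)
    rintro _ ⟨w, x, hw, rfl⟩ v hv
    refine tensorVec_apply_ne ?_ _
    rintro rfl
    exact hv (mem_box.2 hw)
  · intro f hf
    rw [eq_sum_tensorVec hf]
    exact Submodule.sum_mem _ fun w hw => tensorVec_mem_truncSpace (mem_box.1 hw) (f w)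

theorem mem_truncSpace {q : ι → ℕ} {f : Fock n E} :
    f ∈ truncSpace n E q ↔ ∀ w ∉ box n q, f w = 0 := by
  rw [truncSpace_eq]
  rfl

instance truncSpace.finiteDimensional (q : ι → ℕ) : FiniteDimensional ℂ (truncSpace n E q) := by
  rw [truncSpace_eq]
  infer_instance

theorem truncSpace_eq_span (q : ι → ℕ) :
    truncSpace n E q = Submodule.span ℂ {f : Fock n E | ∃ (w : Words n) (x : E),
      w ∈ box n q ∧ f = tensorVec w x} := by
  apply le_antisymm
  · intro f hf
    rw [eq_sum_tensorVec (mem_truncSpace.1 hf)]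
    exact Submodule.sum_mem _ fun w hw => Submodule.subset_span ⟨w, f w, hw, rfl⟩
  · rw [Submodule.span_le]
    rintro _ ⟨w, x, hw, rfl⟩
    exact tensorVec_mem_truncSpace (mem_box.1 hw) x

theorem opRank_truncProj (n q : ι → ℕ) :
    opRank (truncProj n ℂ q) = ∏ i, ∑ l ∈ Finset.range (q i + 1), n i ^ l := by
  rw [opRank, truncProj, Submodule.range_starProjection, truncSpace_eq,
    (supportedOnEquiv n ℂ q).finrank_eq, Module.finrank_fintype_fun_eq_card, Fintype.card_coe,
    card_box]

theorem rankRatio_eq (N : Submodule ℂ (Fock n E)) [N.HasOrthogonalProjection] (q : ι → ℕ) :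
    rankRatio N q = (Module.finrank ℂ ((truncSpace n E q).map
        (N.starProjection : Fock n E →ₗ[ℂ] Fock n E)) : ℝ) /
      ∏ i, ∑ l ∈ Finset.range (q i + 1), (n i : ℝ) ^ l := by
  rw [rankRatio, opRank_truncProj, opRank_starProjection_comp_truncProj]
  push_cast
  rfl

/-! ### The truncated spaces and the creation operators -/

theorem map_creation_truncSpace_le (q : ι → ℕ) (i : ι) (j : Fin (n i)) (m : ℕ) :
    (truncSpace n E (Function.update q i m)).map
        (creation n E i j : Fock n E →ₗ[ℂ] Fock n E) ≤
      truncSpace n E (Function.update q i (m + 1)) := by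
  classical
  rw [truncSpace_eq_span, Submodule.map_span_le]
  rintro _ ⟨w, x, hw, rfl⟩
  rw [ContinuousLinearMap.coe_coe, creation_tensorVec]
  refine tensorVec_mem_truncSpace (fun r => ?_) x
  have hr := mem_box.1 hw r
  by_cases h : r = i
  · subst h
    simp [prepend] at hr ⊢
    omega
  · simpa [prepend, h] using hr

/-- A basis word whose `i`-th entry has length `m + 1` is a letter times a word of length `m`; all
others are already in the smaller truncation. -/
theorem truncSpace_le_sup_map_creation (q : ι → ℕ) (i : ι) (m : ℕ) :
    truncSpace n E (Function.update q i (m + 1)) ≤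
      truncSpace n E (Function.update q i m) ⊔
        ⨆ j, (truncSpace n E (Function.update q i m)).map
          (creation n E i j : Fock n E →ₗ[ℂ] Fock n E) := by
  classical
  rw [truncSpace_eq_span (Function.update q i (m + 1)), Submodule.span_le]
  rintro _ ⟨w, x, hw, rfl⟩
  have hw := mem_box.1 hw
  rcases Nat.lt_or_ge m (w i).length with h | h
  · obtain ⟨j, u, hu⟩ : ∃ j u, w i = FreeMonoid.of j * u := by
      revert h
      generalize w i = v
      intro h
      induction v using FreeMonoid.casesOn with
      | one => simp at h
      | of_mul j u => exact ⟨j, u, rfl⟩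
    refine Submodule.mem_sup_right (Submodule.mem_iSup_of_mem j
      ⟨tensorVec (Function.update w i u) x, tensorVec_mem_truncSpace (fun r => ?_) x, ?_⟩)
    · have hr := hw r
      by_cases h : r = i
      · subst h
        simp [hu] at hr ⊢
        omega
      · simpa [h] using hr
    · rw [ContinuousLinearMap.coe_coe, creation_tensorVec]
      congr 1
      simp [prepend, ← hu]
  · refine Submodule.mem_sup_left (tensorVec_mem_truncSpace (fun r => ?_) x)
    have hr := hw r
    by_cases h : r = i
    · subst h
      simpa
    · simpa [h] using hr

theorem truncSpace_mono {q q' : ι → ℕ} (h : q ≤ q') : truncSpace n E q ≤ truncSpace n E q' :=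
  fun _ hf => mem_truncSpace.2 fun w hw => mem_truncSpace.1 hf w fun hw' =>
    hw (mem_box.2 fun i => (mem_box.1 hw' i).trans (h i))

end Trunc

/-! ### Iterated limits of antitone functions -/

/-- Any `q'` above `q` is reached by unit steps in single coordinates; the induction on the sum of
`q'` undoes one step at a time. -/
theorem antitone_of_update_succ_le {ι : Type*} [Fintype ι] [DecidableEq ι] {a : (ι → ℕ) → ℝ}
    (h : ∀ q i m, a (Function.update q i (m + 1)) ≤ a (Function.update q i m)) : Antitone a := by
  intro q q' hq
  induction hs : ∑ i, q' i generalizing q' with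
  | zero =>
    have hq' : q' = 0 := funext fun i => (Finset.sum_eq_zero_iff.1 hs) i (Finset.mem_univ i)
    rw [le_antisymm hq (hq' ▸ fun i => Nat.zero_le _)]
  | succ s ih =>
    by_cases hne : ∃ i, q i < q' i
    · obtain ⟨i, hi⟩ := hne
      obtain ⟨m, hm⟩ : ∃ m, q' i = m + 1 := ⟨q' i - 1, by omega⟩
      have h1 := h q' i m
      rw [← hm, Function.update_eq_self] at h1
      refine h1.trans (ih (fun r => ?_) ?_)
      · by_cases hr : r = i
        · subst hr
          simp
          omega
        · simpa [hr] using hq r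
      · rw [Finset.sum_update_of_mem (Finset.mem_univ i)]
        rw [Finset.sum_eq_add_sum_sdiff_singleton_of_mem (Finset.mem_univ i)] at hs
        omega
    · push Not at hne
      rw [le_antisymm hq hne]

/-- An infimum over tuples is an iterated infimum, and the partial infimum `b m` is again antitone
in the first coordinate, so each limit in turn is an infimum. -/
theorem HasIteratedLim.of_antitone : ∀ {k : ℕ} {a : (Fin k → ℕ) → ℝ} {L : ℝ},
    Antitone a → IsGLB (Set.range a) L → HasIteratedLim k a L
  | 0, a, L, _, h => by
    have : Set.range a = {a Fin.elim0} := by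
      ext x
      simp only [Set.mem_range, Set.mem_singleton_iff]
      exact ⟨fun ⟨q, hq⟩ => by rw [← hq, Subsingleton.elim q], fun hx => ⟨_, hx.symm⟩⟩
    rw [this] at h
    exact isGLB_singleton.unique h
  | k + 1, a, L, ha, h => by
    have hcons : ∀ {m m' : ℕ} {q q' : Fin k → ℕ}, m ≤ m' → q ≤ q' →
        a (Fin.cons m' q') ≤ a (Fin.cons m q) := fun hm hq => ha (Fin.cons_le_cons.2 ⟨hm, hq⟩)
    have hb : ∀ m : ℕ, ∃ b, IsGLB (Set.range fun q : Fin k → ℕ => a (Fin.cons m q)) b := fun m =>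
      Real.exists_isGLB (Set.range_nonempty _)
        ⟨L, by rintro _ ⟨q, rfl⟩; exact h.1 ⟨_, rfl⟩⟩
    choose b hb using hb
    refine ⟨b, fun m => HasIteratedLim.of_antitone (fun q q' hq => hcons le_rfl hq) (hb m),
      tendsto_atTop_isGLB (fun m m' hm => (hb m).2 ?_) ⟨?_, fun c hc => h.2 ?_⟩⟩
    · rintro _ ⟨q, rfl⟩
      exact ((hb m').1 ⟨q, rfl⟩).trans (hcons hm le_rfl)
    · rintro _ ⟨m, rfl⟩
      refine (hb m).2 ?_
      rintro _ ⟨q, rfl⟩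
      exact h.1 ⟨_, rfl⟩
    · rintro _ ⟨q, rfl⟩
      refine (hc ⟨q 0, rfl⟩).trans ((hb (q 0)).1 ⟨Fin.tail q, ?_⟩)
      simp

/-- A nonnegative antitone function has an iterated limit, which is also its limit along
`atTop`. -/
theorem exists_hasIteratedLim_of_antitone {k : ℕ} {a : (Fin k → ℕ) → ℝ} (ha : Antitone a)
    (h0 : ∀ q, 0 ≤ a q) : ∃ L, HasIteratedLim k a L ∧ Tendsto a atTop (𝓝 L) := by
  obtain ⟨L, hL⟩ := Real.exists_isGLB (Set.range_nonempty a)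
    ⟨0, by rintro _ ⟨q, rfl⟩; exact h0 q⟩
  exact ⟨L, .of_antitone ha hL, tendsto_atTop_isGLB ha hL⟩

/-! ### Monotonicity of the rank ratio -/

/-- If the increments of `d` grow at most by the factor `n`, then `d m / ∑_{l ≤ m} n ^ l` is
antitone. -/
theorem div_geom_sum_succ_le {n : ℕ} {d : ℕ → ℝ} (h0 : d 1 - d 0 ≤ n * d 0)
    (h : ∀ m, d (m + 2) - d (m + 1) ≤ n * (d (m + 1) - d m)) (m : ℕ) :
    d (m + 1) / ∑ l ∈ Finset.range (m + 2), (n : ℝ) ^ l ≤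
      d m / ∑ l ∈ Finset.range (m + 1), (n : ℝ) ^ l := by
  have hpos : ∀ m, (0 : ℝ) < ∑ l ∈ Finset.range (m + 1), (n : ℝ) ^ l := fun m => by
    rw [Finset.sum_range_succ']
    have : (0 : ℝ) ≤ ∑ l ∈ Finset.range m, (n : ℝ) ^ (l + 1) := by positivity
    simpa using by linarith
  -- This is the claim after clearing denominators, because consecutive geometric sums differ by `n
  -- ^ (m + 1)`.
  have key : ∀ m, (d (m + 1) - d m) * ∑ l ∈ Finset.range (m + 1), (n : ℝ) ^ l ≤
      (n : ℝ) ^ (m + 1) * d m := by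
    intro m
    induction m with
    | zero => simpa using h0
    | succ m ih =>
      have h1 := mul_le_mul_of_nonneg_right (h m) (hpos (m + 1)).le
      have h2 := mul_le_mul_of_nonneg_left ih (Nat.cast_nonneg (α := ℝ) n)
      rw [Finset.sum_range_succ] at h1 ⊢
      calc _ ≤ _ := h1
        _ = n * ((d (m + 1) - d m) * ∑ l ∈ Finset.range (m + 1), (n : ℝ) ^ l) +
            n ^ (m + 2) * (d (m + 1) - d m) := by ring
        _ ≤ n * (n ^ (m + 1) * d m) + n ^ (m + 2) * (d (m + 1) - d m) := by gcongr
        _ = _ := by ring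
  rw [div_le_div_iff₀ (hpos _) (hpos _), Finset.sum_range_succ _ (m + 1)]
  linarith [key m]

theorem finrank_iSup_le_sum {V : Type*} [AddCommGroup V] [Module ℂ V] {m : ℕ}
    (C : Fin m → Submodule ℂ V) [∀ j, FiniteDimensional ℂ (C j)] :
    Module.finrank ℂ (⨆ j, C j : Submodule ℂ V) ≤ ∑ j, Module.finrank ℂ (C j) := by
  rw [← Finset.sup_univ_eq_iSup]
  induction (Finset.univ : Finset (Fin m)) using Finset.induction_on with
  | empty => simp
  | insert j s hj ih =>
    rw [Finset.sup_insert, Finset.sum_insert hj]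
    have : FiniteDimensional ℂ (s.sup C : Submodule ℂ V) :=
      Submodule.finiteDimensional_finset_sup s C
    exact (Submodule.finrank_add_le_finrank_add_finrank _ _).trans (by omega)

/-- If `T_j U ≤ V` for all `j ≤ n`, then adding `T_1 V, …, T_n V` to `V` increases the dimension
at most by `n (dim V - dim U)`. -/
theorem finrank_le_of_le_sup_map {X : Type*} [AddCommGroup X] [Module ℂ X] {m : ℕ}
    {U V V' : Submodule ℂ X} [FiniteDimensional ℂ V] (T : Fin m → X →ₗ[ℂ] X) (hUV : U ≤ V)
    (hU : ∀ j, U.map (T j) ≤ V) (hV' : V' ≤ V ⊔ ⨆ j, V.map (T j)) :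
    (Module.finrank ℂ V' : ℝ) - Module.finrank ℂ V ≤
      m * ((Module.finrank ℂ V : ℝ) - Module.finrank ℂ U) := by
  have hfU : FiniteDimensional ℂ U := Submodule.finiteDimensional_of_le hUV
  -- Since `V = U ⊔ C` and `T_j U ≤ V`, only the images of a complement `C` can leave `V`, and `dim
  -- C = dim V - dim U`.
  obtain ⟨C', hC'⟩ := Submodule.exists_isCompl (U.submoduleOf V)
  set C : Submodule ℂ X := C'.map V.subtype with hC
  have hCV : U ⊔ C = V := by
    have h1 := congrArg (Submodule.map V.subtype) hC'.sup_eq_top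
    rw [Submodule.map_sup, Submodule.map_top, Submodule.range_subtype, Submodule.submoduleOf,
      Submodule.map_comap_subtype, inf_eq_right.2 hUV] at h1
    exact h1
  have hfC : FiniteDimensional ℂ C := Submodule.finiteDimensional_of_le (hCV ▸ le_sup_right)
  have hdim : Module.finrank ℂ U + Module.finrank ℂ C = Module.finrank ℂ V := by
    rw [← Submodule.finrank_add_eq_of_isCompl hC', hC,
      Submodule.finrank_map_subtype_eq, (Submodule.submoduleOfEquivOfLe hUV).finrank_eq]
  have hle : V' ≤ V ⊔ ⨆ j, C.map (T j) := by
    refine hV'.trans (sup_le le_sup_left (iSup_le fun j => ?_))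
    rw [← hCV, Submodule.map_sup, hCV]
    exact sup_le ((hU j).trans le_sup_left)
      ((le_iSup (fun j => C.map (T j)) j).trans le_sup_right)
  have h1 := Submodule.finrank_mono hle
  have h2 := Submodule.finrank_add_le_finrank_add_finrank V (⨆ j, C.map (T j))
  have h3 := finrank_iSup_le_sum fun j => C.map (T j)
  have h4 : ∑ j : Fin m, Module.finrank ℂ (C.map (T j)) ≤ m * Module.finrank ℂ C := by
    refine (Finset.sum_le_sum fun j _ => Submodule.finrank_map_le (T j) C).trans ?_
    simp
  have h5 : (Module.finrank ℂ V' : ℝ) ≤ Module.finrank ℂ V + m * Module.finrank ℂ C := by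
    exact_mod_cast h1.trans (h2.trans (by omega))
  have h6 : (Module.finrank ℂ U : ℝ) + Module.finrank ℂ C = Module.finrank ℂ V := by
    exact_mod_cast hdim
  rw [← h6]
  linarith

/-- If `N` is coinvariant then `P_N S = P_N S P_N`. -/
theorem starProjection_creation {ι : Type*} [DecidableEq ι] {n : ι → ℕ} {E : Type*} [NormedAddCommGroup E]
    [InnerProductSpace ℂ E] [FiniteDimensional ℂ E] {N : Submodule ℂ (Fock n E)} [N.HasOrthogonalProjection]
    (hN : IsCoinvariant N) (i : ι) (j : Fin (n i)) (f : Fock n E) :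
    N.starProjection (creation n E i j (N.starProjection f)) =
      N.starProjection (creation n E i j f) := by
  rw [← sub_eq_zero, ← map_sub, ← map_sub, Submodule.starProjection_apply_eq_zero_iff,
    Submodule.mem_orthogonal]
  intro g hg
  rw [← ContinuousLinearMap.adjoint_inner_left, inner_sub_right, sub_eq_zero,
    ← Submodule.inner_starProjection_left_eq_right,
    Submodule.starProjection_eq_self_iff.2 (hN i j g hg)]

theorem rankRatio_nonneg {ι : Type*} {n : ι → ℕ} {E : Type*} [NormedAddCommGroup E]
    [InnerProductSpace ℂ E] [FiniteDimensional ℂ E] {N : Submodule ℂ (Fock n E)}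
    [N.HasOrthogonalProjection] (q : ι → ℕ) : 0 ≤ rankRatio N q := by
  unfold rankRatio
  positivity

/-- The compression of the truncated space to `N`. -/
def compressed {ι : Type*} {n : ι → ℕ} {E : Type*} [NormedAddCommGroup E]
    [InnerProductSpace ℂ E] [FiniteDimensional ℂ E] (N : Submodule ℂ (Fock n E))
    [N.HasOrthogonalProjection] (q : ι → ℕ) :
    Submodule ℂ (Fock n E) :=
  (truncSpace n E q).map (N.starProjection : Fock n E →ₗ[ℂ] Fock n E)

/-- Coinvariance makes the inner projection redundant, so inclusions between truncations and their
images under creation operators carry over to the compressions. -/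
theorem map_compressed {ι : Type*} [DecidableEq ι] {n : ι → ℕ} {E : Type*} [NormedAddCommGroup E]
    [InnerProductSpace ℂ E] [FiniteDimensional ℂ E] {N : Submodule ℂ (Fock n E)}
    [N.HasOrthogonalProjection] (hN : IsCoinvariant N) (q : ι → ℕ) (i : ι) (j : Fin (n i)) :
    (compressed N q).map ((N.starProjection : Fock n E →ₗ[ℂ] Fock n E) ∘ₗ
        (creation n E i j : Fock n E →ₗ[ℂ] Fock n E)) =
      ((truncSpace n E q).map (creation n E i j : Fock n E →ₗ[ℂ] Fock n E)).map
        (N.starProjection : Fock n E →ₗ[ℂ] Fock n E) := by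
  rw [compressed, ← Submodule.map_comp, ← Submodule.map_comp]
  congr 1
  ext1 f
  exact starProjection_creation hN i j f

section Rank

variable {ι : Type*} [Fintype ι] [DecidableEq ι] {n : ι → ℕ} {E : Type*} [NormedAddCommGroup E]
  [InnerProductSpace ℂ E] [FiniteDimensional ℂ E]

instance compressed.finiteDimensional (N : Submodule ℂ (Fock n E)) [N.HasOrthogonalProjection]
    (q : ι → ℕ) : FiniteDimensional ℂ (compressed N q) := by
  unfold compressed
  infer_instance

variable {N : Submodule ℂ (Fock n E)} [N.HasOrthogonalProjection]

theorem compressed_mono {q q' : ι → ℕ} (h : q ≤ q') : compressed N q ≤ compressed N q' :=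
  Submodule.map_mono (truncSpace_mono h)

theorem map_compressed_le (hN : IsCoinvariant N) (q : ι → ℕ) (i : ι) (m : ℕ) (j : Fin (n i)) :
    (compressed N (Function.update q i m)).map
        ((N.starProjection : Fock n E →ₗ[ℂ] Fock n E) ∘ₗ
          (creation n E i j : Fock n E →ₗ[ℂ] Fock n E)) ≤
      compressed N (Function.update q i (m + 1)) := by
  rw [map_compressed hN]
  exact Submodule.map_mono (map_creation_truncSpace_le q i j m)

theorem compressed_succ_le (hN : IsCoinvariant N) (q : ι → ℕ) (i : ι) (m : ℕ) :
    compressed N (Function.update q i (m + 1)) ≤ compressed N (Function.update q i m) ⊔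
      ⨆ j, (compressed N (Function.update q i m)).map
        ((N.starProjection : Fock n E →ₗ[ℂ] Fock n E) ∘ₗ
          (creation n E i j : Fock n E →ₗ[ℂ] Fock n E)) := by
  simp_rw [map_compressed hN]
  rw [← Submodule.map_iSup, compressed, compressed, ← Submodule.map_sup]
  exact Submodule.map_mono (truncSpace_le_sup_map_creation q i m)

/-- With all other coordinates fixed, three consecutive compressions in direction `i` play the roles
of `U`, `V`, `V'` in `finrank_le_of_le_sup_map`. -/
theorem rankRatio_antitone (hN : IsCoinvariant N) : Antitone (rankRatio N) := by
  refine antitone_of_update_succ_le fun q i m => ?_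
  have hle : ∀ m, Function.update q i m ≤ Function.update q i (m + 1) := fun m =>
    update_le_update_iff.2 ⟨m.le_succ, fun _ _ => le_rfl⟩
  have h := div_geom_sum_succ_le (n := n i)
    (d := fun m => Module.finrank ℂ (compressed N (Function.update q i m)))
    (by
      -- The first increment has no predecessor; `U = ⊥` gives the bound `n * d 0`.
      have := finrank_le_of_le_sup_map _ bot_le (by simp) (compressed_succ_le hN q i 0)
      simpa using this)
    (fun m => finrank_le_of_le_sup_map _ (compressed_mono (hle m)) (map_compressed_le hN q i m)
      (compressed_succ_le hN q i (m + 1))) m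
  -- Only the `i`-th factor of the denominator depends on `m`; the others form a common positive
  -- constant.
  have hden : ∀ m, ∏ r, ∑ l ∈ Finset.range (Function.update q i m r + 1), (n r : ℝ) ^ l =
      (∑ l ∈ Finset.range (m + 1), (n i : ℝ) ^ l) *
        ∏ r ∈ Finset.univ \ {i}, ∑ l ∈ Finset.range (q r + 1), (n r : ℝ) ^ l := by
    intro m
    rw [Finset.prod_eq_mul_prod_sdiff_singleton_of_mem (Finset.mem_univ i), Function.update_self]
    congr 1
    refine Finset.prod_congr rfl fun r hr => ?_
    rw [Function.update_of_ne (by simpa using hr)]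
  rw [rankRatio_eq, rankRatio_eq, hden, hden, ← div_div, ← div_div]
  exact div_le_div_of_nonneg_right h (by positivity)

/-- The joint limit is recorded with the iterated one because it is the one that can be multiplied
over blocks of variables. -/
theorem exists_hasEulerChar {k : ℕ} (e : ι ≃ Fin k) (hN : IsCoinvariant N) :
    ∃ c, HasEulerChar e N c ∧
      Tendsto (fun q : Fin k → ℕ => rankRatio N fun i => q (e i)) atTop (𝓝 c) :=
  exists_hasIteratedLim_of_antitone
    (fun _ _ hq => rankRatio_antitone hN fun i => hq (e i)) fun _ => rankRatio_nonneg _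

end Rank

/-! ### Elementary tensors -/

open Classical in
theorem tensorVec_zero {ι : Type*} {n : ι → ℕ} {E : Type*} [NormedAddCommGroup E] (w : Words n) :
    tensorVec w (0 : E) = 0 :=
  lp.single_zero (E := fun _ : Words n => E) 2 w

open Classical in
theorem tensorVec_add {ι : Type*} {n : ι → ℕ} {E : Type*} [NormedAddCommGroup E] (w : Words n)
    (x y : E) : tensorVec w (x + y) = tensorVec w x + tensorVec w y :=
  lp.single_add (E := fun _ : Words n => E) 2 w x y

open Classical in
theorem tensorVec_smul {ι : Type*} {n : ι → ℕ} {E : Type*} [NormedAddCommGroup E]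
    [InnerProductSpace ℂ E] (w : Words n) (c : ℂ) (x : E) :
    tensorVec w (c • x) = c • tensorVec w x :=
  lp.single_smul (E := fun _ : Words n => E) 2 w c x

/-- Boxes are cofinal among finite sets: each finite set lies in the box of its coordinate
projections. -/
theorem tendsto_piFinset_atTop {p : ℕ} (W : Fin p → Type*) :
    Tendsto (fun s : ∀ i, Finset (W i) => Fintype.piFinset s) atTop atTop := by
  classical
  refine tendsto_atTop.2 fun u => ?_
  filter_upwards [eventually_ge_atTop fun i => u.image fun v => v i] with s hs v hv
  exact Fintype.mem_piFinset.2 fun i => hs i (Finset.mem_image_of_mem _ hv)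

theorem tendsto_eval_finset_atTop {p : ℕ} (W : Fin p → Type*) (i : Fin p) :
    Tendsto (fun s : ∀ i, Finset (W i) => s i) atTop atTop := by
  refine tendsto_atTop.2 fun u => ?_
  filter_upwards [eventually_ge_atTop (Function.update (fun _ => ∅) i u)] with s hs
  simpa using hs i

/-- Absolute convergence allows summation along boxes, where the finite sums factor. -/
theorem hasSum_prod_pi {p : ℕ} {W : Fin p → Type*} {g : ∀ i, W i → ℂ} {a : Fin p → ℂ}
    (hg : ∀ i, HasSum (g i) (a i)) : HasSum (fun v : (∀ i, W i) => ∏ i, g i (v i)) (∏ i, a i) := by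
  classical
  have hs : Summable fun v : (∀ i, W i) => ∏ i, g i (v i) := by
    refine Summable.of_norm ?_
    simp_rw [norm_prod]
    exact summable_prod_pi (fun i v => ‖g i v‖) (fun _ _ => norm_nonneg _)
      fun i => (hg i).summable.norm
  have h1 := hs.hasSum.comp (tendsto_piFinset_atTop W)
  have h2 : Tendsto (fun s : ∀ i, Finset (W i) => ∏ i, ∑ v ∈ s i, g i v) atTop
      (𝓝 (∏ i, a i)) :=
    tendsto_finsetProd _ fun i _ => (hg i).comp (tendsto_eval_finset_atTop W i)
  have h3 : ∏ i, a i = ∑' v : (∀ i, W i), ∏ i, g i (v i) := by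
    refine tendsto_nhds_unique h2 (h1.congr fun s => ?_)
    exact (Finset.prod_univ_sum _ _).symm
  rw [h3]
  exact hs.hasSum

theorem FinTensor.span_range_tprod {p : ℕ} (E : Fin p → Type*) [∀ i, NormedAddCommGroup (E i)]
    [∀ i, InnerProductSpace ℂ (E i)] [∀ i, FiniteDimensional ℂ (E i)] :
    Submodule.span ℂ (Set.range (FinTensor.tprod E)) = ⊤ :=
  PiTensorProduct.span_tprod_eq_top

theorem update_apply_words {p : ℕ} {κ : Fin p → ℕ} {n : ∀ i, Fin (κ i) → ℕ} {E : Fin p → Type*}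
    [∀ i, NormedAddCommGroup (E i)] [DecidableEq (Fin p)] (f : ∀ i, Fock (n i) (E i)) (i : Fin p)
    (x : Fock (n i) (E i)) (w : ∀ i, Words (n i)) :
    (fun r => (Function.update f i x r : Fock (n r) (E r)) (w r)) =
      Function.update (fun r => f r (w r)) i (x (w i)) := by
  funext r
  by_cases h : r = i
  · subst h
    simp
  · simp [h]

section Tensor

variable {p : ℕ} {κ : Fin p → ℕ} {n : ∀ i, Fin (κ i) → ℕ} {E : Fin p → Type*}
  [∀ i, NormedAddCommGroup (E i)] [∀ i, InnerProductSpace ℂ (E i)]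
  [∀ i, FiniteDimensional ℂ (E i)]

theorem fockTensor_apply (f : ∀ i, Fock (n i) (E i)) (w : Words (concat n)) :
    fockTensor f w = FinTensor.tprod E fun i => f i fun r => w ⟨i, r⟩ :=
  rfl

theorem fockTensor_apply_eq_zero {f : ∀ i, Fock (n i) (E i)} {w : Words (concat n)} (i : Fin p)
    (h : f i (fun r => w ⟨i, r⟩) = 0) : fockTensor f w = 0 := by
  rw [fockTensor_apply]
  exact MultilinearMap.map_coord_zero _ i h

/-- Grouping the words by blocks turns the sum over tuples into a sum over a product, whose terms
factor by `FinTensor.inner_tprod`. -/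
theorem inner_fockTensor (f g : ∀ i, Fock (n i) (E i)) :
    inner ℂ (fockTensor f) (fockTensor g) = ∏ i, inner ℂ (f i) (g i) := by
  have h1 := hasSum_prod_pi fun i => lp.hasSum_inner (𝕜 := ℂ) (f i) (g i)
  have h2 := (Equiv.hasSum_iff
    (Equiv.piCurry fun (i : Fin p) (r : Fin (κ i)) => FreeMonoid (Fin (n i r)) :
      Words (concat n) ≃ ∀ i, Words (n i))).2 h1
  refine (lp.hasSum_inner (𝕜 := ℂ) (fockTensor f) (fockTensor g)).unique ?_
  exact (funext fun w => FinTensor.inner_tprod E _ _ :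
    (fun w => inner ℂ (fockTensor f w) (fockTensor g w)) = _) ▸ h2

variable (n E) in
/-- The elementary tensor `f_1 ⊗ ⋯ ⊗ f_p`, as a multilinear map. -/
def fockTensorMultilinear :
    MultilinearMap ℂ (fun i => Fock (n i) (E i)) (Fock (concat n) (FinTensor E)) where
  toFun := fockTensor
  map_update_add' f i x y := by
    apply lp.ext
    funext w
    have h := fun z => congrArg (FinTensor.tprod E) (update_apply_words f i z fun i r => w ⟨i, r⟩)
    exact (h _).trans ((MultilinearMap.map_update_add _ _ _ _ _).trans
      (congrArg₂ (· + ·) (h x).symm (h y).symm))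
  map_update_smul' f i c x := by
    apply lp.ext
    funext w
    have h := fun z => congrArg (FinTensor.tprod E) (update_apply_words f i z fun i r => w ⟨i, r⟩)
    exact (h _).trans ((MultilinearMap.map_update_smul _ _ _ _ _).trans
      (congrArg (c • ·) (h x).symm))

/-- The span of the elementary tensors of vectors in given subspaces. -/
def algTensor (H : ∀ i, Submodule ℂ (Fock (n i) (E i))) :
    Submodule ℂ (Fock (concat n) (FinTensor E)) :=
  Submodule.span ℂ {g | ∃ f : ∀ i, Fock (n i) (E i), (∀ i, f i ∈ H i) ∧ g = fockTensor f}

theorem fockTensor_mem_algTensor {H : ∀ i, Submodule ℂ (Fock (n i) (E i))}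
    {f : ∀ i, Fock (n i) (E i)} (hf : ∀ i, f i ∈ H i) : fockTensor f ∈ algTensor H :=
  Submodule.subset_span ⟨f, hf, rfl⟩

/-- Elementary tensors of orthonormal basis vectors are orthonormal, and by multilinearity they
span. -/
theorem finrank_algTensor (H : ∀ i, Submodule ℂ (Fock (n i) (E i)))
    [∀ i, FiniteDimensional ℂ (H i)] :
    Module.finrank ℂ (algTensor H) = ∏ i, Module.finrank ℂ (H i) := by
  classical
  let b := fun i => stdOrthonormalBasis ℂ (H i)
  let v : (∀ i, Fin (Module.finrank ℂ (H i))) → Fock (concat n) (FinTensor E) :=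
    fun j => fockTensor fun i => (b i (j i) : Fock (n i) (E i))
  have hv : Orthonormal ℂ v := by
    rw [orthonormal_iff_ite]
    intro j j'
    have : ∀ i, inner ℂ (b i (j i) : Fock (n i) (E i)) (b i (j' i) : Fock (n i) (E i)) =
        if j i = j' i then (1 : ℂ) else 0 := fun i =>
      orthonormal_iff_ite.1 (b i).orthonormal (j i) (j' i)
    simp only [v]
    rw [inner_fockTensor]
    simp_rw [this]
    rw [Finset.prod_ite_zero]
    simp [funext_iff]
  have hspan : algTensor H = Submodule.span ℂ (Set.range v) := by
    apply le_antisymm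
    · rw [algTensor, Submodule.span_le]
      rintro _ ⟨f, hf, rfl⟩
      have hsum : f = fun i => ∑ j, (b i).repr ⟨f i, hf i⟩ j • (b i j : Fock (n i) (E i)) := by
        funext i
        have := congrArg Subtype.val ((b i).sum_repr ⟨f i, hf i⟩)
        simpa using this.symm
      change fockTensorMultilinear n E f ∈ _
      rw [hsum, MultilinearMap.map_sum]
      refine Submodule.sum_mem _ fun j _ => ?_
      rw [MultilinearMap.map_smul_univ]
      exact Submodule.smul_mem _ _ (Submodule.subset_span ⟨j, rfl⟩)
    · rw [Submodule.span_le]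
      rintro _ ⟨j, rfl⟩
      exact fockTensor_mem_algTensor fun i => (b i (j i)).2
  rw [hspan, finrank_span_eq_card hv.linearIndependent]
  simp

theorem fockTensor_tensorVec (w : Words (concat n)) (x : ∀ i, E i) :
    fockTensor (fun i => tensorVec (n := n i) (fun r => w ⟨i, r⟩) (x i)) =
      tensorVec w (FinTensor.tprod E x) := by
  apply lp.ext
  funext v
  by_cases h : v = w
  · subst h
    rw [fockTensor_apply, tensorVec_apply_self]
    exact congrArg (FinTensor.tprod E) (funext fun i => tensorVec_apply_self _ _)
  · rw [tensorVec_apply_ne h]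
    obtain ⟨⟨i, r⟩, hs⟩ := Function.ne_iff.1 h
    exact fockTensor_apply_eq_zero i (tensorVec_apply_ne (fun h' => hs (congrFun h' r)) _)

/-- By linearity the coefficient may be taken to be an elementary tensor, and then the vector splits
over blocks. Conversely, an elementary tensor vanishes wherever one factor does. -/
theorem truncSpace_concat (q : (Σ i, Fin (κ i)) → ℕ) :
    truncSpace (concat n) (FinTensor E) q =
      algTensor fun i => truncSpace (n i) (E i) fun r => q ⟨i, r⟩ := by
  apply le_antisymm
  · rw [truncSpace_eq_span, Submodule.span_le]
    rintro _ ⟨w, x, hw, rfl⟩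
    have hx : x ∈ Submodule.span ℂ (Set.range (FinTensor.tprod E)) := by
      rw [FinTensor.span_range_tprod]
      trivial
    induction hx using Submodule.span_induction with
    | mem x hx =>
      obtain ⟨x, rfl⟩ := hx
      rw [← fockTensor_tensorVec]
      exact fockTensor_mem_algTensor fun i =>
        tensorVec_mem_truncSpace (fun r => mem_box.1 hw ⟨i, r⟩) _
    | zero =>
      rw [tensorVec_zero]
      exact zero_mem _
    | add x y _ _ hx hy =>
      rw [tensorVec_add]
      exact add_mem hx hy
    | smul c x _ hx =>
      rw [tensorVec_smul]
      exact Submodule.smul_mem _ c hx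
  · rw [algTensor, Submodule.span_le]
    rintro _ ⟨f, hf, rfl⟩
    refine mem_truncSpace.2 fun w hw => ?_
    rw [mem_box, not_forall] at hw
    obtain ⟨⟨i, r⟩, hr⟩ := hw
    exact fockTensor_apply_eq_zero i
      (mem_truncSpace.1 (hf i) _ fun h => hr (mem_box.1 h r))

/-! ### Tensor products of coinvariant subspaces -/

theorem prepend_self {ι : Type*} [DecidableEq ι] {n : ι → ℕ} (i : ι) (j : Fin (n i))
    (w : Words n) : prepend i j w i = FreeMonoid.of j * w i :=
  Function.update_self _ _ _

theorem prepend_of_ne {ι : Type*} [DecidableEq ι] {n : ι → ℕ} {i r : ι} (h : r ≠ i)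
    (j : Fin (n i)) (w : Words n) : prepend i j w r = w r :=
  Function.update_of_ne h _ _

theorem adjoint_creation_apply {ι : Type*} [DecidableEq ι] {n : ι → ℕ} {E : Type*}
    [NormedAddCommGroup E] [InnerProductSpace ℂ E] [FiniteDimensional ℂ E] (i : ι) (j : Fin (n i))
    (f : Fock n E) (w : Words n) :
    ContinuousLinearMap.adjoint (creation n E i j) f w = f (prepend i j w) := by
  refine ext_inner_left ℂ fun x => ?_
  rw [← inner_tensorVec_left, ContinuousLinearMap.adjoint_inner_right, creation_tensorVec,
    inner_tensorVec_left]

/-- The adjoint evaluates at a word with one letter prepended, which changes only the block `i`. -/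
theorem adjoint_creation_fockTensor (f : ∀ i, Fock (n i) (E i)) (i : Fin p) (r : Fin (κ i))
    (j : Fin (n i r)) :
    ContinuousLinearMap.adjoint (creation (concat n) (FinTensor E) ⟨i, r⟩ j) (fockTensor f) =
      fockTensor (Function.update f i
        (ContinuousLinearMap.adjoint (creation (n i) (E i) r j) (f i))) := by
  apply lp.ext
  funext w
  refine (adjoint_creation_apply (n := concat n) (⟨i, r⟩ : Σ i, Fin (κ i)) j _ w).trans
    (congrArg (FinTensor.tprod E) ?_)
  rw [update_apply_words f i _ fun i r => w ⟨i, r⟩]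
  funext i'
  by_cases h : i' = i
  · subst h
    rw [Function.update_self]
    refine (congrArg (f i') (funext fun r' => ?_)).trans (adjoint_creation_apply r j (f i') _).symm
    by_cases hr : r' = r
    · subst hr
      exact (prepend_self (n := concat n) (⟨i', r'⟩ : Σ i, Fin (κ i)) j w).trans
        (prepend_self (n := n i') r' j fun r => w ⟨i', r⟩).symm
    · exact (prepend_of_ne (n := concat n) (i := (⟨i', r⟩ : Σ i, Fin (κ i))) (r := ⟨i', r'⟩)
        (by simpa using hr) j w).trans
        (prepend_of_ne (n := n i') hr j fun r => w ⟨i', r⟩).symm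
  · rw [Function.update_of_ne h]
    refine congrArg (f i') (funext fun r' => ?_)
    simp [prepend, h]

theorem isCoinvariant_orthogonal {ι : Type*} [DecidableEq ι] {n : ι → ℕ} {E : Type*}
    [NormedAddCommGroup E] [InnerProductSpace ℂ E] [FiniteDimensional ℂ E]
    {M : Submodule ℂ (Fock n E)} (hM : IsInvariant M) : IsCoinvariant Mᗮ := by
  intro i j f hf g hg
  rw [ContinuousLinearMap.adjoint_inner_right]
  exact hf _ (hM i j g hg)

variable {N : ∀ i, Submodule ℂ (Fock (n i) (E i))}

theorem isCoinvariant_tensorSubspace (hN : ∀ i, IsCoinvariant (N i)) :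
    IsCoinvariant (tensorSubspace N) := by
  rintro ⟨i, r⟩ j f hf
  set T := ContinuousLinearMap.adjoint (creation (concat n) (FinTensor E) ⟨i, r⟩ j)
  have hle : tensorSubspace N ≤ (tensorSubspace N).comap
      (T : Fock (concat n) (FinTensor E) →ₗ[ℂ] Fock (concat n) (FinTensor E)) := by
    refine Submodule.topologicalClosure_minimal _ (Submodule.span_le.2 ?_)
      ((Submodule.isClosed_topologicalClosure _).preimage T.continuous)
    rintro _ ⟨f, hf, rfl⟩
    refine Submodule.le_topologicalClosure _ (Submodule.subset_span
      ⟨_, fun i' => ?_, adjoint_creation_fockTensor f i r j⟩)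
    by_cases h : i' = i
    · subst h
      rw [Function.update_self]
      exact hN i' r j _ (hf i')
    · rw [Function.update_of_ne h]
      exact hf i'
  exact hle hf

/-! ### Projections and rank ratios of tensor products -/

variable [∀ i, (N i).HasOrthogonalProjection]

/-- Pairing with an elementary tensor of vectors `g i ∈ N i` does not see the projections, which are
self-adjoint and fix `g i`. So the difference is orthogonal to the spanning set. -/
theorem starProjection_fockTensor (f : ∀ i, Fock (n i) (E i)) :
    (tensorSubspace N).starProjection (fockTensor f) =
      fockTensor fun i => (N i).starProjection (f i) := by
  refine Submodule.eq_starProjection_of_mem_of_inner_eq_zero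
    (Submodule.le_topologicalClosure _ (Submodule.subset_span
      ⟨_, fun i => Submodule.starProjection_apply_mem _ _, rfl⟩)) fun g hg => ?_
  -- As membership in a closed subspace, the orthogonality passes from elementary tensors to their
  -- closed span.
  rw [← Submodule.mem_orthogonal_singleton_iff_inner_right]
  revert g
  refine Submodule.topologicalClosure_minimal _ (Submodule.span_le.2 ?_)
    (Submodule.isClosed_orthogonal _)
  rintro _ ⟨g, hg, rfl⟩
  rw [SetLike.mem_coe, Submodule.mem_orthogonal_singleton_iff_inner_right, inner_sub_left,
    inner_fockTensor, inner_fockTensor, sub_eq_zero]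
  refine Finset.prod_congr rfl fun i _ => ?_
  rw [Submodule.inner_starProjection_left_eq_right,
    Submodule.starProjection_eq_self_iff.2 (hg i)]

theorem compressed_tensorSubspace (q : (Σ i, Fin (κ i)) → ℕ) :
    compressed (tensorSubspace N) q = algTensor fun i => compressed (N i) fun r => q ⟨i, r⟩ := by
  rw [compressed, truncSpace_concat]
  apply le_antisymm
  · rw [algTensor, Submodule.map_span_le]
    rintro _ ⟨f, hf, rfl⟩
    rw [ContinuousLinearMap.coe_coe, starProjection_fockTensor]
    exact fockTensor_mem_algTensor fun i => Submodule.mem_map_of_mem (hf i)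
  · rw [algTensor, Submodule.span_le]
    rintro _ ⟨f, hf, rfl⟩
    choose g hg hgf using hf
    refine ⟨fockTensor g, fockTensor_mem_algTensor hg, ?_⟩
    rw [ContinuousLinearMap.coe_coe, starProjection_fockTensor]
    exact congrArg fockTensor (funext hgf)

/-- Dimensions of the compressions and the geometric sums both factor over the blocks, so this is an
identity for each `q`, before any limit. -/
theorem rankRatio_tensorSubspace (q : (Σ i, Fin (κ i)) → ℕ) :
    rankRatio (tensorSubspace N) q = ∏ i, rankRatio (N i) fun r => q ⟨i, r⟩ := by
  simp_rw [rankRatio_eq]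
  rw [Finset.prod_div_distrib, Fintype.prod_sigma, ← Nat.cast_prod]
  congr 2
  exact (congrArg (fun H : Submodule ℂ _ => Module.finrank ℂ H)
    (compressed_tensorSubspace q)).trans (finrank_algTensor _)

theorem tendsto_block (i : Fin p) :
    Tendsto (fun (q : Fin (∑ i, κ i) → ℕ) (r : Fin (κ i)) => q (finSigmaFinEquiv ⟨i, r⟩))
      atTop atTop := by
  refine tendsto_atTop.2 fun b => ?_
  -- The constant threshold `∑ r, b r` dominates every `b r`, whatever positions the block occupies.
  filter_upwards [eventually_ge_atTop fun _ => ∑ r, b r] with q hq r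
  exact (Finset.single_le_sum (f := b) (fun _ _ => Nat.zero_le _) (Finset.mem_univ r)).trans (hq _)

/-- The Euler characteristic of a tensor product of coinvariant subspaces is the product of
their Euler characteristics. -/
theorem hasEulerChar_tensorSubspace (hN : ∀ i, IsCoinvariant (N i)) :
    HasEulerChar finSigmaFinEquiv (tensorSubspace N)
      (∏ i, eulerChar (Equiv.refl (Fin (κ i))) (N i)) := by
  obtain ⟨c, hc, hlim⟩ := exists_hasEulerChar finSigmaFinEquiv (isCoinvariant_tensorSubspace hN)
  have hlim' : Tendsto (fun q : Fin (∑ i, κ i) → ℕ =>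
      rankRatio (tensorSubspace N) fun s => q (finSigmaFinEquiv s)) atTop
      (𝓝 (∏ i, eulerChar (Equiv.refl (Fin (κ i))) (N i))) := by
    simp_rw [rankRatio_tensorSubspace]
    refine tendsto_finsetProd _ fun i _ => ?_
    obtain ⟨c, hc, hlim⟩ := exists_hasEulerChar (Equiv.refl (Fin (κ i))) (hN i)
    rw [HasEulerChar.eulerChar_eq hc]
    have hlim' : Tendsto (rankRatio (N i)) atTop (𝓝 c) := hlim
    exact hlim'.comp (tendsto_block i)
  -- The value `c` of the iterated limit is also the joint limit, which has just been computed as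
  -- the product.
  rwa [tendsto_nhds_unique hlim' hlim]

end Tensor

end Polyball

end

open Polyball
theorem theorem2p4 {p : ℕ} (κ : Fin p → ℕ) (n : ∀ i, Fin (κ i) → ℕ) (hn : ∀ i r, 1 ≤ n i r)
    (E : Fin p → Type*) [∀ i, NormedAddCommGroup (E i)] [∀ i, InnerProductSpace ℂ (E i)]
    [∀ i, FiniteDimensional ℂ (E i)]
    (M : ∀ i, Submodule ℂ (Fock (n i) (E i))) (hM : ∀ i, IsInvariant (M i)) :
    IsCoinvariant (tensorSubspace fun i => (M i)ᗮ) ∧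
    (∀ i, ∃ c, HasEulerChar (Equiv.refl (Fin (κ i))) (M i)ᗮ c) ∧
    (∃ c, HasEulerChar finSigmaFinEquiv (tensorSubspace fun i => (M i)ᗮ) c) ∧
    eulerChar finSigmaFinEquiv (tensorSubspace fun i => (M i)ᗮ) =
      ∏ i, eulerChar (Equiv.refl (Fin (κ i))) (M i)ᗮ := by
  have hN := fun i => isCoinvariant_orthogonal (hM i)
  have h := hasEulerChar_tensorSubspace hN
  exact ⟨isCoinvariant_tensorSubspace hN,
    fun i => (exists_hasEulerChar _ (hN i)).imp fun _ hc => hc.1, ⟨_, h⟩, h.eulerChar_eq⟩
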